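/- All graphs are finite and simple. Definitions. For a graph $G$ and $S\subseteq V(G)$, a \emph{full component} of $S$ is a connected component $A$ of $G-S$ with $N(A)=S$; $S$ is a \emph{minimal separator} if it has at least two full components. A minimal separator $S$ is \emph{subordinate} if there are a minimal separator $S'\supseteq S$ and two distinct full components $A',B'$ of $S'$ such that some full component of $S$ is disjoint from $A'\cup S'\cup B'$. A graph is \emph{mesh} if its complement is not connected. A minimal separator is \emph{mixed} if it is not subordinate and exactly one of its full components induces a mesh graph; it then has exactly two full components, a mesh one $A$ and a non-mesh one $B$. Given a mixed minimal separator $S$ and a set $\widetilde S\subseteq V(G)$, a component of $G-\widetilde S$ is \emph{clarified} if it is disjoint from $A\cup B$. In a rooted forest roots have depth $1$, every vertex is an ancestor of itself, and a path is vertical if one of its ends is an ancestor of the other. For a positive integer $d$, a \emph{treedepth-$d$ structure} in $G$ is a rooted forest $\mathcal T$ with $V(\mathcal T)\subseteq V(G)$, all of whose vertices have depth at most $d$, such that for every edge $uv$ of $G$ with $u,v\in V(\mathcal T)$ one of $u,v$ is an ancestor of the other in $\mathcal T$. It is \emph{maximal} if there is no treedepth-$d$ structure $\mathcal T'$ in $G$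 such that $\mathcal T$ is a proper induced subgraph of $\mathcal T'$ and every root of $\mathcal T$ is a root of $\mathcal T'$. A minimal separator $S$ is \emph{$\mathcal T$-avoiding} if $S\cap V(\mathcal T)$ is contained in a vertical path of $\mathcal T$ and contains no vertex of depth $d$ in $\mathcal T$. Proposition. For each positive integer $d$ there exists a polynomial-time algorithm which takes as input a graph $G$ with no induced path on six vertices and a set $\widetilde S\subseteq V(G)$, and returns a collection $\mathcal S'\subseteq 2^{V(G)}$ such that for every maximal treedepth-$d$ structure $\mathcal T$ in $G$ and every $\mathcal T$-avoiding mixed minimal separator $S$ of $G$ there exists $S'\in\mathcal S'$ such that (i) $\widetilde S\subseteq S'$; (ii) $S'\cap V(\mathcal T)\subseteq S\cup\widetilde S$; and (iii) for each clarified component $\widetilde D$ of $G-\widetilde S$, no connected component of $G[\widetilde D\setminus S']$ intersects more than one connected component of $G-S$. -/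

import Mathlib

/-! ### Graphs: components, minimal separators -/

namespace Carving

variable {V : Type*}

/-- `D` is (the vertex set of) a connected component of the induced subgraph `G[U]`.
With `U = Sᶜ` these are the components of `G - S`. -/
def IsComponentIn (G : SimpleGraph V) (U D : Set V) : Prop :=
  ∃ c : (G.induce U).ConnectedComponent, D = Subtype.val '' c.supp

/-- The open neighbourhood `N(A)` of a set of vertices. -/
def nbhd (G : SimpleGraph V) (A : Set V) : Set V :=
  {v | v ∉ A ∧ ∃ a ∈ A, G.Adj a v}

/-- `A` is a full component (full side) of `S`: a component of `G - S` with `N(A) = S`. -/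
def IsFullComponent (G : SimpleGraph V) (S A : Set V) : Prop :=
  IsComponentIn G Sᶜ A ∧ nbhd G A = S

/-- `S` is a minimal separator: it has at least two full components. -/
def IsMinimalSeparator (G : SimpleGraph V) (S : Set V) : Prop :=
  ∃ A B : Set V, A ≠ B ∧ IsFullComponent G S A ∧ IsFullComponent G S B

/-- The graph `G[A]` is mesh: its complement is not connected. -/
def IsMesh (G : SimpleGraph V) (A : Set V) : Prop :=
  ¬ ((G.induce A)ᶜ).Connected

/-- `S` is a subordinate minimal separator. -/
def IsSubordinate (G : SimpleGraph V) (S : Set V) : Prop :=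
  IsMinimalSeparator G S ∧
    ∃ S' A' B' : Set V, A' ≠ B' ∧ IsFullComponent G S' A' ∧ IsFullComponent G S' B' ∧
      S ⊆ S' ∧ ∃ C : Set V, IsFullComponent G S C ∧ Disjoint C (A' ∪ S' ∪ B')

/-- `S` is a mixed minimal separator: it is not subordinate and exactly one of its full
components is mesh. -/
def IsMixed (G : SimpleGraph V) (S : Set V) : Prop :=
  IsMinimalSeparator G S ∧ ¬ IsSubordinate G S ∧
    ∃! A : Set V, IsFullComponent G S A ∧ IsMesh G A

/-- For a mixed minimal separator `S`, the set `D` is a clarified component of `G - X`: it is a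
component of `G - X` disjoint from `A ∪ B`, where `A` and `B` are the mesh and the non-mesh full
side of `S` (each is unique, since a non-subordinate minimal separator has exactly two full
sides). -/
def IsClarified (G : SimpleGraph V) (S X D : Set V) : Prop :=
  IsComponentIn G Xᶜ D ∧
    ∃ A B : Set V, IsFullComponent G S A ∧ IsMesh G A ∧ IsFullComponent G S B ∧ ¬ IsMesh G B ∧
      Disjoint D (A ∪ B)

/-- `G` has no induced path on six vertices. -/
def IsP6Free (G : SimpleGraph V) : Prop :=
  ¬ (SimpleGraph.pathGraph 6).IsIndContained G

/-! ### Rooted forests and treedepth structures -/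

/-- A rooted forest with vertex set `verts ⊆ V`, given by parent pointers. The depth (roots have
depth 1) is determined on `verts` by the parent pointers, and its existence says that the parent
pointers contain no cycle. Values outside `verts` are irrelevant. -/
structure RootedForest (V : Type*) where
  verts : Set V
  parent : V → Option V
  depth : V → ℕ
  parent_mem : ∀ v ∈ verts, ∀ u, parent v = some u → u ∈ verts
  depth_root : ∀ v ∈ verts, parent v = none → depth v = 1
  depth_child : ∀ v ∈ verts, ∀ u, parent v = some u → depth v = depth u + 1

namespace RootedForest

/-- `v` is a root. -/
def IsRoot (T : RootedForest V) (v : V) : Prop :=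
  v ∈ T.verts ∧ T.parent v = none

/-- `u` and `v` are joined by an edge of the forest. -/
def Adj (T : RootedForest V) (u v : V) : Prop :=
  u ∈ T.verts ∧ v ∈ T.verts ∧ (T.parent u = some v ∨ T.parent v = some u)

/-- `u` is an ancestor of `v`; every vertex is an ancestor of itself. -/
def IsAncestor (T : RootedForest V) (u v : V) : Prop :=
  v ∈ T.verts ∧ Relation.ReflTransGen (fun x y => T.parent x = some y) v u

/-- `u` and `v` are connected by a vertical path. -/
def Comparable (T : RootedForest V) (u v : V) : Prop :=
  T.IsAncestor u v ∨ T.IsAncestor v u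

/-- `P` is the vertex set of a vertical path, that is, of the path between some vertex `w` and an
ancestor `a` of `w`. -/
def IsVerticalPath (T : RootedForest V) (P : Set V) : Prop :=
  ∃ a w : V, T.IsAncestor a w ∧ P = {x | T.IsAncestor a x ∧ T.IsAncestor x w}

/-- `T` is a proper induced subgraph of `T'` and every root of `T` is a root of `T'`. -/
def ProperlyExtendedBy (T T' : RootedForest V) : Prop :=
  T.verts ⊂ T'.verts ∧
    (∀ u ∈ T.verts, ∀ v ∈ T.verts, (T.Adj u v ↔ T'.Adj u v)) ∧
    ∀ v, T.IsRoot v → T'.IsRoot v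

/-- `T` is a treedepth-`d` structure in `G`: it has height at most `d` and is an elimination
forest of the subgraph of `G` induced by its vertices. -/
def IsTreedepthStructure (T : RootedForest V) (G : SimpleGraph V) (d : ℕ) : Prop :=
  (∀ v ∈ T.verts, T.depth v ≤ d) ∧
    ∀ u ∈ T.verts, ∀ v ∈ T.verts, G.Adj u v → T.Comparable u v

/-- `T` is a maximal treedepth-`d` structure in `G`. -/
def IsMaximalTreedepthStructure (T : RootedForest V) (G : SimpleGraph V) (d : ℕ) : Prop :=
  T.IsTreedepthStructure G d ∧
    ¬ ∃ T' : RootedForest V, T'.IsTreedepthStructure G d ∧ T.ProperlyExtendedBy T'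

end RootedForest

/-- The set `S` (a minimal separator) is `T`-avoiding, for a treedepth-`d` structure `T`: `S ∩ T`
is contained in a vertical path of `T` and has no depth-`d` vertex. -/
def IsAvoiding (T : RootedForest V) (d : ℕ) (S : Set V) : Prop :=
  (∃ P : Set V, T.IsVerticalPath P ∧ S ∩ T.verts ⊆ P) ∧
    ∀ v ∈ S ∩ T.verts, T.depth v ≠ d

/-! ### The machine model

A random access machine, programmed by structured (while) programs. The memory consists of
natural-number variables and of two-dimensional arrays of natural numbers, whose cells are
addressed by computed indices. The only arithmetic is addition and truncated subtraction, at unit cost, so that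
numbers with more than polynomially many bits cannot arise in polynomial time. -/

/-- Expressions; `get a i j` reads the cell `(i, j)` of the array `a`. -/
inductive Expr where
  | const (k : ℕ)
  | var (x : ℕ)
  | get (a : ℕ) (i j : Expr)
  | add (e₁ e₂ : Expr)
  | sub (e₁ e₂ : Expr)

/-- The contents of the memory. -/
structure State where
  vars : ℕ → ℕ
  arrs : ℕ → ℕ → ℕ → ℕ

namespace Expr

/-- The value of an expression. -/
def eval (s : State) : Expr → ℕ
  | const k => k
  | var x => s.vars x
  | get a i j => s.arrs a (i.eval s) (j.eval s)
  | add e₁ e₂ => e₁.eval s + e₂.eval s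
  | sub e₁ e₂ => e₁.eval s - e₂.eval s

/-- The number of steps needed to evaluate an expression: one for every operation in it. -/
def cost : Expr → ℕ
  | const _ => 1
  | var _ => 1
  | get _ i j => i.cost + j.cost + 1
  | add e₁ e₂ => e₁.cost + e₂.cost + 1
  | sub e₁ e₂ => e₁.cost + e₂.cost + 1

end Expr

namespace State

/-- Overwrite the variable `x`. -/
def setVar (s : State) (x k : ℕ) : State :=
  { s with vars := fun y => if y = x then k else s.vars y }

/-- Overwrite the cell `(i, j)` of the array `a`. -/
def setArr (s : State) (a i j k : ℕ) : State :=
  { s with arrs := fun a' i' j' => if a' = a ∧ i' = i ∧ j' = j then k else s.arrs a' i' j' }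

end State

/-- Programs; a condition is true when its value is not `0`. -/
inductive Prog where
  | skip
  | assign (x : ℕ) (e : Expr)
  | put (a : ℕ) (i j e : Expr)
  | seq (c₁ c₂ : Prog)
  | cond (e : Expr) (c₁ c₂ : Prog)
  | loop (e : Expr) (c : Prog)

/-- `Exec c s t s'`: the program `c`, started with memory `s`, halts after `t` steps with
memory `s'`. -/
inductive Exec : Prog → State → ℕ → State → Prop where
  | skip (s : State) : Exec Prog.skip s 1 s
  | assign (x : ℕ) (e : Expr) (s : State) :
      Exec (Prog.assign x e) s (e.cost + 1) (s.setVar x (e.eval s))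
  | put (a : ℕ) (i j e : Expr) (s : State) :
      Exec (Prog.put a i j e) s (i.cost + j.cost + e.cost + 1)
        (s.setArr a (i.eval s) (j.eval s) (e.eval s))
  | seq {c₁ c₂ : Prog} {s s' s'' : State} {t t' : ℕ} :
      Exec c₁ s t s' → Exec c₂ s' t' s'' → Exec (Prog.seq c₁ c₂) s (t + t') s''
  | cond_true {e : Expr} {c₁ c₂ : Prog} {s s' : State} {t : ℕ} :
      e.eval s ≠ 0 → Exec c₁ s t s' → Exec (Prog.cond e c₁ c₂) s (e.cost + 1 + t) s'
  | cond_false {e : Expr} {c₁ c₂ : Prog} {s s' : State} {t : ℕ} :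
      e.eval s = 0 → Exec c₂ s t s' → Exec (Prog.cond e c₁ c₂) s (e.cost + 1 + t) s'
  | loop_done {e : Expr} {c : Prog} {s : State} :
      e.eval s = 0 → Exec (Prog.loop e c) s (e.cost + 1) s
  | loop_step {e : Expr} {c : Prog} {s s' s'' : State} {t t' : ℕ} :
      e.eval s ≠ 0 → Exec c s t s' → Exec (Prog.loop e c) s' t' s'' →
      Exec (Prog.loop e c) s (e.cost + 1 + t + t') s''

open Classical in
/-- The initial memory on the input `(G, X)`, where `G` is a graph with vertices `0, …, n - 1` and
`X` is a set of vertices: variable `0` holds `n`, array `0` holds the adjacency matrix of `G`,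
row `0` of array `1` holds the indicator vector of `X`, and everything else is `0`. -/
noncomputable def inputState {n : ℕ} (G : SimpleGraph (Fin n)) (X : Set (Fin n)) : State where
  vars := fun x => if x = 0 then n else 0
  arrs := fun a i j =>
    if (a = 0 ∧ ∃ u v : Fin n, (u : ℕ) = i ∧ (v : ℕ) = j ∧ G.Adj u v) ∨
        (a = 1 ∧ i = 0 ∧ ∃ v : Fin n, (v : ℕ) = j ∧ v ∈ X)
    then 1 else 0

/-- The number of sets in the list that is read off the final memory: the value of variable `1`. -/
def outputLength (s : State) : ℕ := s.vars 1

/-- The family of vertex sets that is read off the final memory: its members are given by the rows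
`0, …, outputLength s - 1` of array `2`, as indicator vectors (non-zero means membership). -/
def outputFamily (n : ℕ) (s : State) : Set (Set (Fin n)) :=
  {X | ∃ i < outputLength s, X = {v : Fin n | s.arrs 2 i (v : ℕ) ≠ 0}}

end Carving

/-!
Let `A` and `B` be two full sides of `S`, and call a component of `G - X` clear if it avoids
`A ∪ B`. A clear component `D` is cut along `S` by removing its frontier, the vertices of `S ∩ D`
with a neighbour in `D \ S`.

Two frontier vertices in different clear components, together with their neighbours outside `S`,
have a common neighbour in every connected part of `A` that both of them see, because a shortest
connection through that part would contain an induced path on six vertices. It follows that for each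
`a ∈ A` there is `a' ∈ A` such that all frontier vertices outside a single clear component `E₁` are
adjacent to `a` or `a'`; likewise for each `p ∈ B` there are `b ∈ B` and `E₂`. If `G[B]` is not
mesh, then there are `p, q ∈ B` such that each vertex of `S` adjacent to neither is complete to `A`.
So the frontier is contained in a subset of `S ∪ X` that is determined by `a, a', p, q, b` and
one vertex in each of `E₁`, `E₂`, and an algorithm can list the candidates for all tuples of seven
vertices. No treedepth structure enters the construction.
-/

namespace Carving

variable {V : Type*} {G : SimpleGraph V}

/-! ### Distances and induced paths -/

section Distance

variable {x y : V}

theorem le_add_dist_of_forall_adj {f : V → ℕ} (hf : ∀ a b, G.Adj a b → f b ≤ f a + 1)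
    (h : G.Reachable x y) : f y ≤ f x + G.dist x y := by
  obtain ⟨w, hw⟩ := h.exists_walk_length_eq_dist
  rw [← hw]
  clear hw h
  induction w with
  | nil => simp
  | cons hadj w ih =>
    have := hf _ _ hadj
    rw [SimpleGraph.Walk.length_cons]
    lia

theorem pathGraph_isIndContained_of_le_dist {k : ℕ} (h : G.Reachable x y) (hk : k ≤ G.dist x y) :
    (SimpleGraph.pathGraph (k + 1)).IsIndContained G := by
  obtain ⟨w, hw⟩ := h.exists_walk_length_eq_dist
  have hdist (i : Fin (k + 1)) : G.dist x (w.getVert i) = i := by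
    rw [← SimpleGraph.length_eq_dist_of_subwalk hw (w.isSubwalk_take i),
      SimpleGraph.Walk.take_length]
    lia
  have hinj : Function.Injective fun i : Fin (k + 1) => w.getVert i := fun i j hij => by
    rw [Fin.ext_iff, ← hdist i, ← hdist j]
    exact congrArg _ hij
  have hadj (i j : Fin (k + 1)) :
      G.Adj (w.getVert i) (w.getVert j) ↔ (SimpleGraph.pathGraph (k + 1)).Adj i j := by
    rw [SimpleGraph.pathGraph_adj]
    constructor
    · intro h
      have hne : (i : ℕ) ≠ j := fun hij => h.ne (congrArg _ hij)
      have := h.diff_dist_adj (u := x)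
      rw [hdist, hdist] at this
      lia
    · rintro (h | h)
      · exact h ▸ w.adj_getVert_succ (by lia)
      · exact h ▸ (w.adj_getVert_succ (by lia)).symm
  exact ⟨⟨⟨_, hinj⟩, fun {i j} => hadj i j⟩⟩

theorem IsP6Free.induce (hG : IsP6Free G) (W : Set V) : IsP6Free (G.induce W) :=
  fun h => hG (h.trans ⟨SimpleGraph.Embedding.induce W⟩)

theorem IsP6Free.dist_le_four (hG : IsP6Free G) (x y : V) : G.dist x y ≤ 4 := by
  by_contra! h
  exact hG (pathGraph_isIndContained_of_le_dist (.of_dist_ne_zero (by lia)) h)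

end Distance

/-! ### Connected components -/

section Components

variable {U C D D' P : Set V} {x y : V}

theorem exists_adj_mem_notMem (hC : (G.induce C).Preconnected) (hx : x ∈ C) (hy : y ∈ C)
    (hxP : x ∈ P) (hyP : y ∉ P) : ∃ a ∈ C, ∃ b ∈ C, a ∈ P ∧ b ∉ P ∧ G.Adj a b := by
  obtain ⟨w⟩ := hC ⟨x, hx⟩ ⟨y, hy⟩
  obtain ⟨d, -, ha, hb⟩ := w.exists_boundary_dart (Subtype.val ⁻¹' P) hxP hyP
  exact ⟨d.fst, d.fst.2, d.snd, d.snd.2, ha, hb, d.adj⟩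

namespace IsComponentIn

theorem subset (h : IsComponentIn G U D) : D ⊆ U := by
  obtain ⟨c, rfl⟩ := h
  exact Subtype.coe_image_subset U c.supp

theorem nonempty (h : IsComponentIn G U D) : D.Nonempty := by
  obtain ⟨c, rfl⟩ := h
  exact c.nonempty_supp.image _

theorem preconnected (h : IsComponentIn G U D) : (G.induce D).Preconnected := by
  obtain ⟨c, rfl⟩ := h
  let f : c.toSimpleGraph →g G.induce (Subtype.val '' c.supp) :=
    ⟨fun v => ⟨v, Set.mem_image_of_mem _ v.2⟩, fun h => h⟩
  refine c.connected_toSimpleGraph.preconnected.map f ?_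
  rintro ⟨_, v, hv, rfl⟩
  exact ⟨⟨v, hv⟩, rfl⟩

theorem mem_of_adj (h : IsComponentIn G U D) (hx : x ∈ D) (hy : y ∈ U) (hxy : G.Adj x y) :
    y ∈ D := by
  obtain ⟨c, rfl⟩ := h
  obtain ⟨x, hx, rfl⟩ := hx
  exact ⟨⟨y, hy⟩, c.mem_supp_of_adj_mem_supp hx hxy, rfl⟩

theorem subset_of_preconnected (h : IsComponentIn G U D) (hC : (G.induce C).Preconnected)
    (hCU : C ⊆ U) (hxC : x ∈ C) (hxD : x ∈ D) : C ⊆ D := by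
  intro y hy
  by_contra hyD
  obtain ⟨a, -, b, hb, haD, hbD, hab⟩ := exists_adj_mem_notMem hC hxC hy hxD hyD
  exact hbD (h.mem_of_adj haD (hCU hb) hab)

theorem eq_of_mem (h : IsComponentIn G U D) (h' : IsComponentIn G U D') (hx : x ∈ D)
    (hx' : x ∈ D') : D = D' :=
  (h'.subset_of_preconnected h.preconnected h.subset hx hx').antisymm
    (h.subset_of_preconnected h'.preconnected h'.subset hx' hx)

theorem not_adj (h : IsComponentIn G U D) (h' : IsComponentIn G U D') (hne : D ≠ D')
    (hx : x ∈ D) (hy : y ∈ D') : ¬ G.Adj x y := fun hxy =>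
  hne (h.eq_of_mem h' (h.mem_of_adj hx (h'.subset hy) hxy) hy)

end IsComponentIn

theorem exists_isComponentIn_mem (G : SimpleGraph V) (hx : x ∈ U) :
    ∃ D, IsComponentIn G U D ∧ x ∈ D :=
  ⟨_, ⟨(G.induce U).connectedComponentMk ⟨x, hx⟩, rfl⟩, ⟨x, hx⟩, rfl, rfl⟩

end Components

section FullComponents

variable {S A B : Set V} {v x y : V}

namespace IsFullComponent

theorem notMem_separator (h : IsFullComponent G S A) (hx : x ∈ A) : x ∉ S :=
  h.1.subset hx

theorem exists_adj (h : IsFullComponent G S A) (hv : v ∈ S) : ∃ a ∈ A, G.Adj v a := by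
  obtain ⟨-, a, ha, hav⟩ : v ∈ nbhd G A := h.2 ▸ hv
  exact ⟨a, ha, hav.symm⟩

theorem neighborSet_subset (h : IsFullComponent G S A) (hx : x ∈ A) :
    G.neighborSet x ⊆ S ∪ A := by
  intro y hxy
  by_cases hy : y ∈ A
  · exact .inr hy
  · exact .inl (h.2 ▸ ⟨hy, x, hx, hxy⟩)

theorem disjoint (hA : IsFullComponent G S A) (hB : IsFullComponent G S B) (hAB : A ≠ B) :
    Disjoint A B :=
  Set.disjoint_left.mpr fun _ ha hb => hAB (hA.1.eq_of_mem hB.1 ha hb)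

theorem not_adj_of_notMem (h : IsFullComponent G S A) (hxS : x ∉ S) (hxA : x ∉ A) (hy : y ∈ A) :
    ¬ G.Adj x y := fun hxy => (h.neighborSet_subset hy hxy.symm).elim hxS hxA

theorem not_adj (hA : IsFullComponent G S A) (hB : IsFullComponent G S B) (hAB : A ≠ B)
    (hx : x ∈ A) (hy : y ∈ B) : ¬ G.Adj x y :=
  hB.not_adj_of_notMem (hA.notMem_separator hx)
    (Set.disjoint_left.mp (hA.disjoint hB hAB) hx) hy

end IsFullComponent

end FullComponents

theorem IsP6Free.exists_common_adj (hG : IsP6Free G) {C : Set V} {u v u' v' : V}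
    (huv : G.Adj u v) (huv' : G.Adj u' v') (huu : ¬ G.Adj u u') (hu : ¬ G.Adj u v')
    (hu' : ¬ G.Adj v u') (hvv : ¬ G.Adj v v') (huC : ∀ c ∈ C, ¬ G.Adj u c)
    (huC' : ∀ c ∈ C, ¬ G.Adj u' c) (hC : (G.induce C).Preconnected)
    (hv : ∃ c ∈ C, G.Adj v c) (hv' : ∃ c ∈ C, G.Adj v' c) :
    ∃ x ∈ C, G.Adj v x ∧ G.Adj v' x := by
  by_contra! hno
  obtain ⟨c, hc, hvc⟩ := hv
  obtain ⟨c', hc', hvc'⟩ := hv'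
  let W : Set V := {u, v, v', u'} ∪ C
  classical
  -- The potential `f` shows that `u` and `u'` have distance at least 5 in `G[W]`.
  let f (x : V) : ℕ :=
    if x = u then 0 else if x = v then 1 else if x = v' then 4 else if x = u' then 5
    else if G.Adj v x then 2 else 3
  have hlip (a b : W) (hab : (G.induce W).Adj a b) : f b ≤ f a + 1 := by
    obtain ⟨a, ha⟩ := a
    obtain ⟨b, hb⟩ := b
    replace hab : G.Adj a b := hab
    simp only [W, Set.mem_union, Set.mem_insert_iff, Set.mem_singleton_iff] at ha hb
    grind (splits := 20) [SimpleGraph.adj_comm, SimpleGraph.irrefl]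
  have huW : u ∈ W := by grind
  have huW' : u' ∈ W := by grind
  have hvW : v ∈ W := by grind
  have hvW' : v' ∈ W := by grind
  have hCW : C ⊆ W := Set.subset_union_right
  have hreach : (G.induce W).Reachable ⟨u, huW⟩ ⟨u', huW'⟩ := by
    have step {x y : V} (hx : x ∈ W) (hy : y ∈ W) (h : G.Adj x y) :
        (G.induce W).Reachable ⟨x, hx⟩ ⟨y, hy⟩ := SimpleGraph.Adj.reachable h
    have hcc : (G.induce W).Reachable ⟨c, hCW hc⟩ ⟨c', hCW hc'⟩ :=
      (hC ⟨c, hc⟩ ⟨c', hc'⟩).map (SimpleGraph.induceHomOfLE G hCW).toHom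
    exact (step huW hvW huv).trans <| (step hvW (hCW hc) hvc).trans <| hcc.trans <|
      (step (hCW hc') hvW' hvc'.symm).trans (step hvW' huW' huv'.symm)
  have hdist := le_add_dist_of_forall_adj (f := fun x : W => f x) hlip hreach
  have := (hG.induce W).dist_le_four ⟨u, huW⟩ ⟨u', huW'⟩
  have : f u = 0 := if_pos rfl
  have : f u' = 5 := by grind [SimpleGraph.adj_comm, SimpleGraph.irrefl]
  grind

/-! ### Modules and dominating pairs -/

/-- `K` is a module of `G[B]`: no vertex of `B` outside `K` distinguishes two vertices of `K`. -/
def IsModuleIn (G : SimpleGraph V) (B K : Set V) : Prop :=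
  K ⊆ B ∧ ∀ y ∈ B \ K, ∀ k ∈ K, ∀ k' ∈ K, G.Adj y k → G.Adj y k'

section Modules

variable {B M M' : Set V}

theorem IsModuleIn.union (hM : IsModuleIn G B M) (hM' : IsModuleIn G B M')
    (hne : (M ∩ M').Nonempty) : IsModuleIn G B (M ∪ M') := by
  obtain ⟨m, hm, hm'⟩ := hne
  refine ⟨Set.union_subset hM.1 hM'.1, fun y ⟨hy, hyM⟩ k hk k' hk' hyk => ?_⟩
  rw [Set.mem_union, not_or] at hyM
  have hym : G.Adj y m := hk.elim (fun hk => hM.2 y ⟨hy, hyM.1⟩ k hk m hm hyk)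
    fun hk => hM'.2 y ⟨hy, hyM.2⟩ k hk m hm' hyk
  exact hk'.elim (fun hk' => hM.2 y ⟨hy, hyM.1⟩ m hm k' hk' hym)
    fun hk' => hM'.2 y ⟨hy, hyM.2⟩ m hm' k' hk' hym

theorem isMesh_of_forall_adj (hM : (B ∩ M).Nonempty) (hBM : (B \ M).Nonempty)
    (hadj : ∀ x ∈ B ∩ M, ∀ y ∈ B \ M, G.Adj x y) : IsMesh G B := by
  intro hconn
  obtain ⟨m, hm⟩ := hM
  obtain ⟨y, hy⟩ := hBM
  obtain ⟨w⟩ := hconn.preconnected ⟨m, hm.1⟩ ⟨y, hy.1⟩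
  obtain ⟨d, -, hd, hd'⟩ := w.exists_boundary_dart (Subtype.val ⁻¹' M) hm.2 hy.2
  exact d.adj.2 (hadj _ ⟨d.fst.2, hd⟩ _ ⟨d.snd.2, hd'⟩)

theorem isMesh_of_isModuleIn_of_union_eq (hM : IsModuleIn G B M) (hM' : IsModuleIn G B M')
    (hMB : M' ≠ B) (hunion : M ∪ M' = B) {m x : V} (hm : m ∈ M) (hx : x ∈ M' \ M)
    (hmx : G.Adj m x) : IsMesh G B := by
  have hxB : x ∈ B := hM'.1 hx.1
  refine isMesh_of_forall_adj ⟨m, hM.1 hm, hm⟩ ⟨x, hxB, hx.2⟩ fun k hk y hy => ?_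
  obtain ⟨z, hzB, hzM'⟩ := Set.exists_of_ssubset (hM'.1.ssubset_of_ne hMB)
  have hzM : z ∈ M := by grind
  have hyM' : y ∈ M' := by grind
  have hxz : G.Adj x z := hM.2 x ⟨hxB, hx.2⟩ m hm z hzM hmx.symm
  have hzy : G.Adj z y := hM'.2 z ⟨hzB, hzM'⟩ x hx.1 y hyM' hxz.symm
  exact (hM.2 y hy z hzM k hk.2 hzy.symm).symm

-- Otherwise, starting from a maximal proper module `M` and an edge leaving it, the proper module
-- `M'` that contains this edge satisfies `M ∪ M' = B`.
theorem exists_pair_forall_isModuleIn_eq (hfin : B.Finite) (hne : B.Nonempty)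
    (hconn : (G.induce B).Preconnected) (hB : ¬ IsMesh G B) :
    ∃ p ∈ B, ∃ q ∈ B, (p = q ∨ G.Adj p q) ∧
      ∀ K, IsModuleIn G B K → p ∈ K → q ∈ K → K = B := by
  by_contra! hcon
  obtain ⟨b, hb⟩ := hne
  obtain ⟨K, hK, hbK, -, hKB⟩ := hcon b hb b hb (.inl rfl)
  obtain ⟨M, ⟨hM, hMB, m₀, hm₀⟩, hmax⟩ :=
    (hfin.finite_subsets.subset fun K hK => hK.1.1 :
      {K | IsModuleIn G B K ∧ K ≠ B ∧ K.Nonempty}.Finite).exists_maximal ⟨K, hK, hKB, b, hbK⟩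
  obtain ⟨x₀, hx₀, hx₀M⟩ := Set.exists_of_ssubset (hM.1.ssubset_of_ne hMB)
  obtain ⟨m, hmB, x, hxB, hm, hx, hmx⟩ := exists_adj_mem_notMem hconn (hM.1 hm₀) hx₀ hm₀ hx₀M
  obtain ⟨M', hM', hm', hx', hM'B⟩ := hcon m hmB x hxB (.inr hmx)
  have hunion : M ∪ M' = B := by
    by_contra hne
    exact hx (hmax ⟨hM.union hM' ⟨m, hm, hm'⟩, hne, m, .inl hm⟩ Set.subset_union_left (.inr hx'))
  exact hB (isMesh_of_isModuleIn_of_union_eq hM hM' hM'B hunion hm ⟨hx', hx⟩ hmx)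

end Modules

section DominatingPair

variable {S A B : Set V} {v : V}

theorem exists_induced_path_of_not_isModuleIn {K : Set V}
    (hK : IsComponentIn G (B \ G.neighborSet v) K)
    (hmod : ¬ IsModuleIn G B K) :
    ∃ b₁ ∈ B, ∃ b₂ ∈ B, ∃ b₃ ∈ B, G.Adj v b₁ ∧ G.Adj b₁ b₂ ∧ G.Adj b₂ b₃ ∧ ¬ G.Adj v b₂ ∧
      ¬ G.Adj v b₃ ∧ ¬ G.Adj b₁ b₃ := by
  have hKB : K ⊆ B := hK.subset.trans Set.sdiff_subset
  simp only [IsModuleIn, hKB, true_and] at hmod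
  push Not at hmod
  obtain ⟨b₁, ⟨hb₁, hb₁K⟩, k, hk, k', hk', hbk, hbk'⟩ := hmod
  have hvb₁ : G.Adj v b₁ := by
    by_contra h
    exact hb₁K (hK.mem_of_adj hk ⟨hb₁, h⟩ hbk.symm)
  obtain ⟨b₂, hb₂, b₃, hb₃, hb₁₂, hb₁₃, hb₂₃⟩ :=
    exists_adj_mem_notMem (P := G.neighborSet b₁) hK.preconnected hk hk' hbk hbk'
  exact ⟨b₁, hb₁, b₂, hKB hb₂, b₃, hKB hb₃, hvb₁, hb₁₂, hb₂₃, (hK.subset hb₂).2,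
    (hK.subset hb₃).2, hb₁₃⟩

-- Otherwise there are induced paths `v b₁ b₂ b₃` into `B` and `v a a₁` into `A`, which together
-- form an induced path on six vertices.
theorem IsP6Free.adj_of_not_isModuleIn (hG : IsP6Free G) (hA : IsFullComponent G S A)
    (hB : IsFullComponent G S B) (hAB : A ≠ B) (hv : v ∈ S) {K : Set V}
    (hK : IsComponentIn G (B \ G.neighborSet v) K) (hmod : ¬ IsModuleIn G B K) :
    ∀ a ∈ A, G.Adj v a := by
  by_contra! ⟨a', ha', hva'⟩
  obtain ⟨b₁, hb₁, b₂, hb₂, b₃, hb₃, hvb₁, hb₁₂, hb₂₃, hvb₂, hvb₃, hb₁₃⟩ :=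
    exists_induced_path_of_not_isModuleIn hK hmod
  obtain ⟨a₀, ha₀, hva₀⟩ := hA.exists_adj hv
  obtain ⟨a, ha, a₁, ha₁, hva, hva₁, haa₁⟩ :=
    exists_adj_mem_notMem (P := G.neighborSet v) hA.1.preconnected ha₀ ha' hva₀ hva'
  have hBA {b a : V} (hb : b ∈ B) (ha : a ∈ A) : ¬ G.Adj b a := hB.not_adj hA hAB.symm hb ha
  have hpair : (G.induce {b₁, v}).Preconnected :=
    (SimpleGraph.induce_pair_connected_of_adj hvb₁.symm).preconnected
  obtain ⟨x, rfl | rfl, hx, hx'⟩ := hG.exists_common_adj (C := {b₁, v}) hb₂₃.symm haa₁.symm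
    (hBA hb₃ ha₁) (hBA hb₃ ha) (hBA hb₂ ha₁) (hBA hb₂ ha)
    (by rintro c (rfl | rfl); exacts [mt G.adj_symm hb₁₃, mt G.adj_symm hvb₃])
    (by rintro c (rfl | rfl); exacts [mt G.adj_symm (hBA hb₁ ha₁), mt G.adj_symm hva₁])
    hpair ⟨b₁, .inl rfl, hb₁₂.symm⟩ ⟨v, .inr rfl, G.adj_symm hva⟩
  · exact hBA hb₁ ha hx'.symm
  · exact hvb₂ hx.symm

theorem IsP6Free.exists_dominating_pair (hG : IsP6Free G) (hfin : B.Finite)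
    (hA : IsFullComponent G S A) (hB : IsFullComponent G S B) (hAB : A ≠ B) (hmesh : ¬ IsMesh G B) :
    ∃ p ∈ B, ∃ q ∈ B, ∀ v ∈ S, G.Adj v p ∨ G.Adj v q ∨ ∀ a ∈ A, G.Adj v a := by
  obtain ⟨p, hp, q, hq, hpq, hmod⟩ :=
    exists_pair_forall_isModuleIn_eq hfin hB.1.nonempty hB.1.preconnected hmesh
  refine ⟨p, hp, q, hq, fun v hv => ?_⟩
  by_contra! ⟨hvp, hvq, a, ha, hva⟩
  obtain ⟨K, hK, hpK⟩ := exists_isComponentIn_mem G (U := B \ G.neighborSet v) ⟨hp, hvp⟩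
  have hqK : q ∈ K := hpq.elim (fun h => h ▸ hpK) fun h => hK.mem_of_adj hpK ⟨hq, hvq⟩ h
  obtain ⟨b, hb, hvb⟩ := hB.exists_adj hv
  have hKmod : ¬ IsModuleIn G B K := fun h => (hK.subset (hmod K h hpK hqK ▸ hb)).2 hvb
  exact hva (hG.adj_of_not_isModuleIn hA hB hAB hv hK hKmod a ha)

end DominatingPair

/-! ### Hitting the frontier -/

-- Choose `x` so that the component of `p` in `B \ N(x)` is maximal, and an edge `cb` of `G[B]` that
-- leaves this component. A vertex `v` with `¬ r x v` and `¬ G.Adj v b` would have a larger one.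
theorem exists_forall_rel_or_adj {B R : Set V} {r : V → V → Prop} {p : V} (hfin : B.Finite)
    (hp : p ∈ B) (hconn : (G.induce B).Preconnected) (hR : R.Nonempty)
    (hadj : ∀ v ∈ R, ∃ y ∈ B, G.Adj v y) (hRp : ∀ v ∈ R, ¬ G.Adj v p)
    (hcommon : ∀ v ∈ R, ∀ w ∈ R, ¬ r v w → ∀ C ⊆ B, (G.induce C).Preconnected →
      (∃ c ∈ C, G.Adj v c) → (∃ c ∈ C, G.Adj w c) → ∃ c ∈ C, G.Adj v c ∧ G.Adj w c) :
    ∃ x ∈ R, ∃ b ∈ B, ∀ v ∈ R, r x v ∨ G.Adj v b := by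
  obtain ⟨C, ⟨x, hxR, hC, hpC⟩, hmax⟩ :=
    (hfin.finite_subsets.subset fun C ⟨_, _, hC, _⟩ => hC.subset.trans Set.sdiff_subset :
      {C | ∃ x ∈ R, IsComponentIn G (B \ G.neighborSet x) C ∧ p ∈ C}.Finite).exists_maximal <| by
        obtain ⟨v, hv⟩ := hR
        obtain ⟨C, hC, hpC⟩ := exists_isComponentIn_mem G (U := B \ G.neighborSet v) ⟨hp, hRp v hv⟩
        exact ⟨C, v, hv, hC, hpC⟩
  obtain ⟨y, hyB, hxy⟩ := hadj x hxR
  obtain ⟨c, -, b, hbB, hcC, hbC, hcb⟩ :=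
    exists_adj_mem_notMem hconn hp hyB hpC fun hy => (hC.subset hy).2 hxy
  have hxb : G.Adj x b := by
    by_contra h
    exact hbC (hC.mem_of_adj hcC ⟨hbB, h⟩ hcb)
  refine ⟨x, hxR, b, hbB, fun v hv => ?_⟩
  by_contra! ⟨hxv, hvb⟩
  obtain ⟨K, hK, hpK⟩ := exists_isComponentIn_mem G
    (U := B \ (G.neighborSet x ∩ G.neighborSet v)) ⟨hp, fun h => hRp x hxR h.1⟩
  have hKB : K ⊆ B := hK.subset.trans Set.sdiff_subset
  have hCK : C ⊆ K := hK.subset_of_preconnected hC.preconnected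
    (hC.subset.trans (Set.sdiff_subset_sdiff_right Set.inter_subset_left)) hpC hpK
  have hbK : b ∈ K := hK.mem_of_adj (hCK hcC) ⟨hbB, fun h => hvb h.2⟩ hcb
  have hKv : K ⊆ B \ G.neighborSet v := fun y hy => ⟨hKB hy, fun hvy => by
    obtain ⟨z, hz, h⟩ := hcommon x hxR v hv hxv K hKB hK.preconnected ⟨b, hbK, hxb⟩ ⟨y, hy, hvy⟩
    exact (hK.subset hz).2 h⟩
  obtain ⟨C', hC', hpC'⟩ := exists_isComponentIn_mem G (hKv hpK)
  have hKC' : K ⊆ C' := hC'.subset_of_preconnected hK.preconnected hKv hpK hpC'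
  exact hbC (hmax ⟨v, hv, hC', hpC'⟩ (hCK.trans hKC') (hKC' hbK))

/-- `D` is a component of `G - X` disjoint from `F`; the clarified components are the case where
`F` is the union of the two full sides of a mixed minimal separator. -/
def IsClear (G : SimpleGraph V) (X F D : Set V) : Prop :=
  IsComponentIn G Xᶜ D ∧ Disjoint D F

/-- The vertices of `S` with a neighbour outside `S` in the same clear component of `G - X`. -/
def frontier (G : SimpleGraph V) (S X F : Set V) : Set V :=
  {v ∈ S | ∃ D, IsClear G X F D ∧ v ∈ D ∧ ∃ u ∈ D \ S, G.Adj u v}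

/-- No component of `G[D \ Y]` intersects two components of `G - S`. -/
def Carves (G : SimpleGraph V) (S D Y : Set V) : Prop :=
  ∀ C, IsComponentIn G (D \ Y) C → ∀ D₁ D₂, IsComponentIn G Sᶜ D₁ → IsComponentIn G Sᶜ D₂ →
    (C ∩ D₁).Nonempty → (C ∩ D₂).Nonempty → D₁ = D₂

section Frontier

variable {S X F D Y B : Set V} {p : V}

theorem carves_of_frontier_subset (hD : IsClear G X F D) (hY : frontier G S X F ⊆ Y) :
    Carves G S D Y := by
  rintro C hC D₁ D₂ hD₁ hD₂ ⟨x, hxC, hx⟩ ⟨y, hyC, hy⟩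
  by_contra hne
  obtain ⟨u, huC, v, hvC, hu, hv, huv⟩ := exists_adj_mem_notMem hC.preconnected hxC hyC hx
    fun hyD₁ => hne (hD₁.eq_of_mem hD₂ hyD₁ hy)
  have hvS : v ∈ S := by
    by_contra h
    exact hv (hD₁.mem_of_adj hu h huv)
  obtain ⟨hvD, hvY⟩ := hC.subset hvC
  exact hvY (hY ⟨hvS, D, hD, hvD, u, ⟨(hC.subset huC).1, hD₁.subset hu⟩, huv⟩)

theorem IsP6Free.exists_common_adj_of_mem_frontier (hG : IsP6Free G) (hB : IsFullComponent G S B)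
    (hBF : B ⊆ F) {v w : V} (hv : v ∈ frontier G S X F) (hw : w ∈ frontier G S X F)
    (hvw : ¬ ∃ D, IsClear G X F D ∧ v ∈ D ∧ w ∈ D) {C : Set V} (hCB : C ⊆ B)
    (hC : (G.induce C).Preconnected) (hvC : ∃ c ∈ C, G.Adj v c) (hwC : ∃ c ∈ C, G.Adj w c) :
    ∃ c ∈ C, G.Adj v c ∧ G.Adj w c := by
  obtain ⟨-, D, hD, hvD, u, ⟨huD, huS⟩, huv⟩ := hv
  obtain ⟨-, D', hD', hwD', u', ⟨huD', huS'⟩, huw'⟩ := hw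
  have hne : D ≠ D' := by
    rintro rfl
    exact hvw ⟨D, hD, hvD, hwD'⟩
  have hfar {y z : V} (hy : y ∈ D) (hz : z ∈ D') : ¬ G.Adj y z := hD.1.not_adj hD'.1 hne hy hz
  have hsep {E : Set V} {y : V} (hE : IsClear G X F E) (hy : y ∈ E) (hyS : y ∉ S) :
      ∀ c ∈ C, ¬ G.Adj y c := fun c hc =>
    hB.not_adj_of_notMem hyS (fun hyB => Set.disjoint_left.mp hE.2 hy (hBF hyB)) (hCB hc)
  exact hG.exists_common_adj huv huw' (hfar huD huD') (hfar huD hwD') (hfar hvD huD')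
    (hfar hvD hwD') (hsep hD huD huS) (hsep hD' huD' huS') hC hvC hwC

theorem IsP6Free.exists_frontier_subset (hG : IsP6Free G) (hfin : B.Finite)
    (hB : IsFullComponent G S B) (hBF : B ⊆ F) (hp : p ∈ B) :
    ∃ b ∈ B, ∃ E, (E = ∅ ∨ IsClear G X F E) ∧
      frontier G S X F ⊆ G.neighborSet p ∪ G.neighborSet b ∪ E := by
  obtain hR | hR := (frontier G S X F \ G.neighborSet p).eq_empty_or_nonempty
  · exact ⟨p, hp, ∅, .inl rfl, by grind⟩
  obtain ⟨x, ⟨⟨-, D, hD, hxD, -⟩, -⟩, b, hb, h⟩ := exists_forall_rel_or_adj hfin hp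
    hB.1.preconnected hR (fun v hv => hB.exists_adj hv.1.1) (fun v hv => mt G.adj_symm hv.2)
    fun v hv w hw hvw C => hG.exists_common_adj_of_mem_frontier hB hBF hv.1 hw.1 hvw
  refine ⟨b, hb, D, .inr hD, fun v hv => ?_⟩
  by_cases hvp : G.Adj p v
  · exact .inl (.inl hvp)
  obtain ⟨E, hE, hxE, hvE⟩ | hvb := h v ⟨hv, hvp⟩
  · exact .inr (hD.1.eq_of_mem hE.1 hxD hxE ▸ hvE)
  · exact .inl (.inr hvb.symm)

end Frontier

/-! ### The candidate sets -/

/-- Some walk of `G[W]` from `x` to `y` has length at most `r`. The recursion is the one that a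
program can follow, without leaving the vertices of `G`. -/
def WithinDist (G : SimpleGraph V) (W : Set V) : ℕ → V → V → Prop
  | 0, x, y => x ∈ W ∧ x = y
  | r + 1, x, y => x ∈ W ∧ ∃ z, (x = z ∨ G.Adj x z) ∧ WithinDist G W r z y

section WithinDist

variable {W D : Set V} {r : ℕ} {x y : V}

theorem WithinDist.mem_left (h : WithinDist G W r x y) : x ∈ W := by
  cases r <;> exact h.1

theorem WithinDist.mem_of_isComponentIn (h : WithinDist G W r x y) (hD : IsComponentIn G W D)
    (hx : x ∈ D) : y ∈ D := by
  induction r generalizing x with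
  | zero => exact h.2 ▸ hx
  | succ r ih =>
    obtain ⟨-, z, rfl | hxz, h⟩ := h
    · exact ih h hx
    · exact ih h (hD.mem_of_adj hx h.mem_left hxz)

theorem withinDist_of_length_le {x y : W} (w : (G.induce W).Walk x y) (hr : w.length ≤ r) :
    WithinDist G W r x y := by
  induction r generalizing x with
  | zero =>
    cases w with
    | nil => exact ⟨y.2, rfl⟩
    | cons _ _ => simp at hr
  | succ r ih =>
    cases w with
    | nil => exact ⟨y.2, y, .inl rfl, ih .nil (Nat.zero_le r)⟩
    | cons hadj w => exact ⟨x.2, _, .inr hadj, ih w (Nat.le_of_succ_le_succ hr)⟩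

theorem IsP6Free.setOf_withinDist_four_eq (hG : IsP6Free G) (hD : IsComponentIn G W D)
    (hx : x ∈ D) : {y | WithinDist G W 4 x y} = D := by
  refine Set.Subset.antisymm (fun y hy => hy.mem_of_isComponentIn hD hx) fun y hy => ?_
  have hxy : (G.induce W).Reachable ⟨x, hD.subset hx⟩ ⟨y, hD.subset hy⟩ :=
    (hD.preconnected ⟨x, hx⟩ ⟨y, hy⟩).map (SimpleGraph.induceHomOfLE G hD.subset).toHom
  obtain ⟨w, hw⟩ := hxy.exists_walk_length_eq_dist
  exact withinDist_of_length_le w (hw ▸ (hG.induce W).dist_le_four _ _)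

end WithinDist

/-- For a graph without an induced path on six vertices, the component of `G - X` containing `e`,
except that `e = a` encodes the empty set. -/
def reach (G : SimpleGraph V) (X : Set V) (a e : V) : Set V :=
  {v | e ≠ a ∧ WithinDist G Xᶜ 4 e v}

/-- The sets returned by the algorithm: a vertex of the frontier is hit by `{a, a'}` or lies in `E`,
it is hit by `{p, b}` or lies in `E`, and it is always hit by `{a, p, q}`. -/
def candidate (G : SimpleGraph V) (X : Set V) (a a' p q b : V) (E : Set V) : Set V :=
  X ∪ (G.neighborSet a ∪ G.neighborSet a') ∩ (G.neighborSet p ∪ G.neighborSet b) ∪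
    E ∩ (G.neighborSet a ∪ G.neighborSet p ∪ G.neighborSet q)

section Candidate

variable {S X F A B E E₁ E₂ : Set V} {a a' p q b : V}

theorem IsP6Free.exists_reach_eq (hG : IsP6Free G) (ha : a ∈ F) (hE : E = ∅ ∨ IsClear G X F E) :
    ∃ e, reach G X a e = E := by
  obtain rfl | hE := hE
  · exact ⟨a, Set.eq_empty_of_forall_notMem fun v hv => hv.1 rfl⟩
  obtain ⟨e, he⟩ := hE.1.nonempty
  have hea : e ≠ a := by
    rintro rfl
    exact Set.disjoint_left.mp hE.2 he ha
  refine ⟨e, ?_⟩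
  simp only [reach, hea, ne_eq, not_false_eq_true, true_and,
    hG.setOf_withinDist_four_eq hE.1 he]

theorem candidate_subset (hA : IsFullComponent G S A) (hB : IsFullComponent G S B) (hAB : A ≠ B)
    (ha : a ∈ A) (ha' : a' ∈ A) (hp : p ∈ B) (hq : q ∈ B) (hb : b ∈ B)
    (hE : Disjoint E (A ∪ B)) : candidate G X a a' p q b E ⊆ S ∪ X := by
  have hNA {x v : V} (hx : x ∈ A) (hv : G.Adj x v) : v ∈ S ∪ A := hA.neighborSet_subset hx hv
  have hNB {x v : V} (hx : x ∈ B) (hv : G.Adj x v) : v ∈ S ∪ B := hB.neighborSet_subset hx hv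
  rintro v ((hvX | ⟨hvA, hvB⟩) | ⟨hvE, hv⟩)
  · exact .inr hvX
  · have hvSA : v ∈ S ∪ A := hvA.elim (hNA ha) (hNA ha')
    have hvSB : v ∈ S ∪ B := hvB.elim (hNB hp) (hNB hb)
    have hvAB : v ∈ A → v ∉ B := fun h => Set.disjoint_left.mp (hA.disjoint hB hAB) h
    grind
  · have hvSAB : v ∈ S ∪ A ∨ v ∈ S ∪ B := by
      obtain (h | h) | h := hv
      exacts [.inl (hNA ha h), .inr (hNB hp h), .inr (hNB hq h)]
    have hvAB : v ∉ A ∪ B := Set.disjoint_left.mp hE hvE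
    grind

theorem frontier_subset_candidate (ha : a ∈ A)
    (hdom : ∀ v ∈ S, G.Adj v p ∨ G.Adj v q ∨ ∀ a ∈ A, G.Adj v a)
    (h₁ : frontier G S X F ⊆ G.neighborSet a ∪ G.neighborSet a' ∪ E₁)
    (h₂ : frontier G S X F ⊆ G.neighborSet p ∪ G.neighborSet b ∪ E₂) :
    frontier G S X F ⊆ candidate G X a a' p q b (E₁ ∪ E₂) := by
  intro v hv
  have hvapq : v ∈ G.neighborSet a ∪ G.neighborSet p ∪ G.neighborSet q := by
    obtain h | h | h := hdom v hv.1
    · exact .inl (.inr h.symm)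
    · exact .inr h.symm
    · exact .inl (.inl (h a ha).symm)
  obtain hvA | hvE := h₁ hv
  · obtain hvB | hvE := h₂ hv
    · exact .inl (.inr ⟨hvA, hvB⟩)
    · exact .inr ⟨.inr hvE, hvapq⟩
  · exact .inr ⟨.inl hvE, hvapq⟩

theorem IsP6Free.exists_candidate (hG : IsP6Free G) (X : Set V) (hAfin : A.Finite)
    (hBfin : B.Finite) (hA : IsFullComponent G S A) (hB : IsFullComponent G S B) (hAB : A ≠ B)
    (hmesh : ¬ IsMesh G B) :
    ∃ a a' p q b e₁ e₂, candidate G X a a' p q b (reach G X a e₁ ∪ reach G X a e₂) ⊆ S ∪ X ∧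
      ∀ D, IsClear G X (A ∪ B) D →
        Carves G S D (candidate G X a a' p q b (reach G X a e₁ ∪ reach G X a e₂)) := by
  obtain ⟨p, hp, q, hq, hdom⟩ := hG.exists_dominating_pair hBfin hA hB hAB hmesh
  obtain ⟨a, ha⟩ := hA.1.nonempty
  obtain ⟨a', ha', E₁, hE₁, hfrontier₁⟩ :=
    hG.exists_frontier_subset (X := X) hAfin hA (Set.subset_union_left (t := B)) ha
  obtain ⟨b, hb, E₂, hE₂, hfrontier₂⟩ :=
    hG.exists_frontier_subset (X := X) hBfin hB (Set.subset_union_right (s := A)) hp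
  obtain ⟨e₁, rfl⟩ := hG.exists_reach_eq (.inl ha) hE₁
  obtain ⟨e₂, rfl⟩ := hG.exists_reach_eq (.inl ha) hE₂
  have hdisj {E : Set V} (hE : E = ∅ ∨ IsClear G X (A ∪ B) E) : Disjoint E (A ∪ B) :=
    hE.elim (fun h => h ▸ Set.empty_disjoint _) And.right
  exact ⟨a, a', p, q, b, e₁, e₂,
    candidate_subset hA hB hAB ha ha' hp hq hb (Set.disjoint_union_left.mpr ⟨hdisj hE₁, hdisj hE₂⟩),
    fun D hD => carves_of_frontier_subset hD
      (frontier_subset_candidate ha hdom hfrontier₁ hfrontier₂)⟩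

end Candidate

theorem IsMixed.exists_sides {S : Set V} (hS : IsMixed G S) :
    ∃ A B, IsFullComponent G S A ∧ IsFullComponent G S B ∧ A ≠ B ∧ ¬ IsMesh G B ∧
      ∀ X D, IsClarified G S X D → IsClear G X (A ∪ B) D := by
  obtain ⟨hmin, hsub, A, ⟨hA, hAmesh⟩, huniq⟩ := hS
  obtain ⟨B, hB, hAB⟩ : ∃ B, IsFullComponent G S B ∧ A ≠ B := by
    obtain ⟨A₁, B₁, hne, hA₁, hB₁⟩ := hmin
    by_cases h : A = A₁
    · exact ⟨B₁, hB₁, h ▸ hne⟩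
    · exact ⟨A₁, hA₁, h⟩
  -- A third full side would witness that `S ⊆ S` is subordinate.
  have hside (C : Set V) (hC : IsFullComponent G S C) (hCA : C ≠ A) : C = B := by
    by_contra hCB
    refine hsub ⟨hmin, S, A, B, hAB, hA, hB, subset_rfl, C, hC, ?_⟩
    exact ((hC.disjoint hA hCA).union_right (Set.disjoint_left.mpr fun _ => hC.notMem_separator)
      ).union_right (hC.disjoint hB hCB)
  refine ⟨A, B, hA, hB, hAB, fun h => hAB (huniq B ⟨hB, h⟩).symm, ?_⟩
  rintro X D ⟨hD, A', B', hA', hA'mesh, hB', hB'mesh, hdisj⟩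
  obtain rfl := huniq A' ⟨hA', hA'mesh⟩
  obtain rfl := hside B' hB' fun h => hB'mesh (h ▸ hAmesh)
  exact ⟨hD, hdisj⟩

/-! ### Programs -/

/-- Total correctness with a time bound: started in `s`, the program `c` halts after at most `T`
steps, in a state that satisfies `Q`. -/
def HaltsWithin (c : Prog) (s : State) (T : ℕ) (Q : State → Prop) : Prop :=
  ∃ t s', Exec c s t s' ∧ t ≤ T ∧ Q s'

section HaltsWithin

variable {c c₁ c₂ : Prog} {s : State} {e : Expr} {T T₁ T₂ : ℕ} {Q R : State → Prop}

theorem HaltsWithin.mono (h : HaltsWithin c s T₁ R) (hT : T₁ ≤ T₂) (hQ : ∀ s', R s' → Q s') :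
    HaltsWithin c s T₂ Q := by
  obtain ⟨t, s', hc, ht, hs'⟩ := h
  exact ⟨t, s', hc, ht.trans hT, hQ s' hs'⟩

theorem haltsWithin_assign {x : ℕ} (h : Q (s.setVar x (e.eval s))) :
    HaltsWithin (.assign x e) s (e.cost + 1) Q :=
  ⟨_, _, .assign x e s, le_rfl, h⟩

theorem haltsWithin_put {a : ℕ} {i j : Expr}
    (h : Q (s.setArr a (i.eval s) (j.eval s) (e.eval s))) :
    HaltsWithin (.put a i j e) s (i.cost + j.cost + e.cost + 1) Q :=
  ⟨_, _, .put a i j e s, le_rfl, h⟩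

theorem HaltsWithin.seq (h₁ : HaltsWithin c₁ s T₁ R) (h₂ : ∀ s', R s' → HaltsWithin c₂ s' T₂ Q) :
    HaltsWithin (.seq c₁ c₂) s (T₁ + T₂) Q := by
  obtain ⟨t₁, s₁, hc₁, ht₁, hs₁⟩ := h₁
  obtain ⟨t₂, s₂, hc₂, ht₂, hs₂⟩ := h₂ s₁ hs₁
  exact ⟨_, s₂, hc₁.seq hc₂, Nat.add_le_add ht₁ ht₂, hs₂⟩

theorem haltsWithin_cond (h₁ : e.eval s ≠ 0 → HaltsWithin c₁ s T Q)
    (h₂ : e.eval s = 0 → HaltsWithin c₂ s T Q) :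
    HaltsWithin (.cond e c₁ c₂) s (e.cost + 1 + T) Q := by
  by_cases he : e.eval s = 0
  · obtain ⟨t, s', hc, ht, hs'⟩ := h₂ he
    exact ⟨_, s', .cond_false he hc, Nat.add_le_add_left ht _, hs'⟩
  · obtain ⟨t, s', hc, ht, hs'⟩ := h₁ he
    exact ⟨_, s', .cond_true he hc, Nat.add_le_add_left ht _, hs'⟩

theorem haltsWithin_loop {I : ℕ → State → Prop} (hdone : ∀ s, I 0 s → e.eval s = 0)
    (hstep : ∀ m s, I (m + 1) s → e.eval s ≠ 0 ∧ HaltsWithin c s T (I m)) {m : ℕ} (hs : I m s) :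
    HaltsWithin (.loop e c) s (m * (e.cost + 1 + T) + (e.cost + 1)) (I 0) := by
  induction m generalizing s with
  | zero => exact ⟨_, s, .loop_done (hdone s hs), by simp, hs⟩
  | succ m ih =>
    obtain ⟨he, t, s', hc, ht, hs'⟩ := hstep m s hs
    obtain ⟨t', s'', hc', ht', hs''⟩ := ih hs'
    exact ⟨_, s'', .loop_step he hc hc', by linarith, hs''⟩

end HaltsWithin

/-- The memory holds the input `(G, X)` and the tuple `x` of vertices: the tuple is kept in the
variables from number `3` on. Variable `1` and array `2` are left to the output, and variable `2`
to the answers of tests. -/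
structure Stores {n k : ℕ} (G : SimpleGraph (Fin n)) (X : Set (Fin n)) (x : Fin k → Fin n)
    (s : State) : Prop where
  size : s.vars 0 = n
  graph : s.arrs 0 = (inputState G X).arrs 0
  set : s.arrs 1 = (inputState G X).arrs 1
  tuple (i : Fin k) : s.vars (3 + i) = x i

/-- Run `c` for every vertex `y`, where variable `3 + k` holds `y`. -/
def forEach (k : ℕ) (c : Prog) : Prog :=
  .seq (.assign (3 + k) (.const 0))
    (.loop (.sub (.var 0) (.var (3 + k)))
      (.seq c (.assign (3 + k) (.add (.var (3 + k)) (.const 1)))))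

section Stores

variable {n k : ℕ} {G : SimpleGraph (Fin n)} {X : Set (Fin n)} {x : Fin k → Fin n} {s : State}

theorem stores_inputState (x : Fin 0 → Fin n) : Stores G X x (inputState G X) :=
  ⟨rfl, rfl, rfl, fun i => i.elim0⟩

theorem stores_snoc {y : Fin n} :
    Stores G X (Fin.snoc x y : Fin (k + 1) → Fin n) s ↔ Stores G X x s ∧ s.vars (3 + k) = y := by
  refine ⟨fun h => ⟨⟨h.size, h.graph, h.set, fun i => ?_⟩, ?_⟩,
    fun ⟨h, hy⟩ => ⟨h.size, h.graph, h.set, fun i => ?_⟩⟩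
  · simpa using h.tuple i.castSucc
  · simpa using h.tuple (Fin.last k)
  · cases i using Fin.lastCases with
    | last => simpa using hy
    | cast i => simpa using h.tuple i

namespace Stores

theorem setVar (h : Stores G X x s) {y : ℕ} (hy : y = 1 ∨ y = 2 ∨ 3 + k ≤ y) (a : ℕ) :
    Stores G X x (s.setVar y a) := by
  refine ⟨?_, h.graph, h.set, fun i => ?_⟩
  · rw [← h.size]
    exact if_neg (by omega)
  · rw [← h.tuple i]
    exact if_neg (by omega)

theorem setArr_two (h : Stores G X x s) (i j a : ℕ) : Stores G X x (s.setArr 2 i j a) :=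
  ⟨h.size, h.graph, h.set, h.tuple⟩

theorem adj_iff (h : Stores G X x s) (i j : Fin k) :
    s.arrs 0 (s.vars (3 + i)) (s.vars (3 + j)) ≠ 0 ↔ G.Adj (x i) (x j) := by
  simp [h.graph, h.tuple, inputState, Fin.val_inj]

theorem mem_iff (h : Stores G X x s) (i : Fin k) :
    s.arrs 1 0 (s.vars (3 + i)) ≠ 0 ↔ x i ∈ X := by
  simp [h.set, h.tuple, inputState, Fin.val_inj]

theorem haltsWithin_forEach {c : Prog} {T : ℕ} {P : ℕ → State → Prop}
    (hP : ∀ i a s, P i s → P i (s.setVar (3 + k) a))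
    (hc : ∀ (y : Fin n) s, Stores G X (Fin.snoc x y : Fin (k + 1) → Fin n) s → P y s →
      HaltsWithin c s T fun s' =>
        Stores G X (Fin.snoc x y : Fin (k + 1) → Fin n) s' ∧ P (y + 1) s')
    (hs : Stores G X x s) (h0 : P 0 s) :
    HaltsWithin (forEach k c) s (n * (T + 8) + 6) fun s' => Stores G X x s' ∧ P n s' := by
  let I (m : ℕ) (s : State) : Prop :=
    Stores G X x s ∧ ∃ i, s.vars (3 + k) = i ∧ i + m = n ∧ P i s
  have hinit : HaltsWithin (.assign (3 + k) (.const 0)) s 2 (I n) :=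
    haltsWithin_assign ⟨hs.setVar (by omega) _, 0, if_pos rfl, Nat.zero_add n, hP _ _ _ h0⟩
  have hdone (s : State) : I 0 s → (Expr.sub (.var 0) (.var (3 + k))).eval s = 0 := by
    rintro ⟨hs, i, hi, hin, -⟩
    simp only [Expr.eval, hs.size]
    omega
  have hstep (m : ℕ) (s : State) : I (m + 1) s →
      (Expr.sub (.var 0) (.var (3 + k))).eval s ≠ 0 ∧
        HaltsWithin (.seq c (.assign (3 + k) (.add (.var (3 + k)) (.const 1)))) s (T + 4)
          (I m) := by
    rintro ⟨hs, i, hi, hin, hPi⟩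
    refine ⟨by simp only [Expr.eval, hs.size]; omega, ?_⟩
    let y : Fin n := ⟨i, by omega⟩
    refine (hc y s (stores_snoc.mpr ⟨hs, hi⟩) hPi).seq fun s' ⟨hs', hPs'⟩ => ?_
    obtain ⟨hs', hy⟩ := stores_snoc.mp hs'
    exact haltsWithin_assign ⟨hs'.setVar (by omega) _, i + 1,
      by simp [State.setVar, Expr.eval, hy, y], by omega, hP _ _ _ hPs'⟩
  refine (hinit.seq fun s' hs' => haltsWithin_loop hdone hstep hs').mono ?_ ?_
  · simp only [Expr.cost]
    linarith
  · rintro s' ⟨hs', i, -, rfl, hPi⟩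
    exact ⟨hs', hPi⟩

end Stores

end Stores

/-- A property of `k` vertices of a graph with a distinguished set of vertices. -/
abbrev Query (k : ℕ) : Type :=
  ∀ n : ℕ, SimpleGraph (Fin n) → Set (Fin n) → (Fin k → Fin n) → Prop

/-- The memory `s'` results from answering in `s` the question whether `φ` holds: the answer is in
variable `2`, and the input and the output written so far are as they were. -/
structure Answers {n k : ℕ} (G : SimpleGraph (Fin n)) (X : Set (Fin n)) (x : Fin k → Fin n)
    (φ : Prop) (s s' : State) : Prop where
  stores : Stores G X x s'
  outputLength_eq : outputLength s' = outputLength s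
  arrs_eq : s'.arrs = s.arrs
  answer_iff : s'.vars 2 ≠ 0 ↔ φ

/-- Some program decides the query `P` in polynomial time. -/
def IsPolyDecidable {k : ℕ} (P : Query k) : Prop :=
  ∃ (c : Prog) (p : Polynomial ℕ), ∀ n G X (x : Fin k → Fin n) s, Stores G X x s →
    HaltsWithin c s (p.eval n) (Answers G X x (P n G X x) s)

namespace Answers

variable {n k : ℕ} {G : SimpleGraph (Fin n)} {X : Set (Fin n)} {x : Fin k → Fin n}
  {φ ψ : Prop} {s s' s'' : State}

theorem trans (h : Answers G X x φ s s') (h' : Answers G X x ψ s' s'') : Answers G X x ψ s s'' :=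
  ⟨h'.stores, h'.outputLength_eq.trans h.outputLength_eq, h'.arrs_eq.trans h.arrs_eq, h'.answer_iff⟩

theorem congr (h : Answers G X x φ s s') (hφ : φ ↔ ψ) : Answers G X x ψ s s' :=
  ⟨h.stores, h.outputLength_eq, h.arrs_eq, h.answer_iff.trans hφ⟩

theorem setVar_of_le (h : Answers G X x φ s s') {y : ℕ} (hy : 3 + k ≤ y) (a : ℕ) :
    Answers G X x φ s (s'.setVar y a) := by
  have hvars {z : ℕ} (hz : z < 3) : (s'.setVar y a).vars z = s'.vars z := if_neg (by omega)
  refine ⟨h.stores.setVar (.inr (.inr hy)) a, ?_, h.arrs_eq, ?_⟩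
  · exact (hvars (by norm_num)).trans h.outputLength_eq
  · rw [hvars (by norm_num)]
    exact h.answer_iff

theorem haltsWithin_assign (hs : Stores G X x s') (hout : outputLength s' = outputLength s)
    (harr : s'.arrs = s.arrs) (e : Expr) (he : e.eval s' ≠ 0 ↔ φ) :
    HaltsWithin (.assign 2 e) s' (e.cost + 1) (Answers G X x φ s) :=
  Carving.haltsWithin_assign ⟨hs.setVar (.inr (.inl rfl)) _, hout, harr, he⟩

end Answers

theorem Stores.haltsWithin_exists {n k T : ℕ} {G : SimpleGraph (Fin n)} {X : Set (Fin n)}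
    {x : Fin k → Fin n} {c : Prog} {φ : Fin n → Prop} {s : State} (hs : Stores G X x s)
    (hc : ∀ y s, Stores G X (Fin.snoc x y : Fin (k + 1) → Fin n) s →
      HaltsWithin c s T (Answers G X (Fin.snoc x y : Fin (k + 1) → Fin n) (φ y) s)) :
    HaltsWithin (.seq (.assign 2 (.const 0)) (forEach k (.cond (.var 2) .skip c))) s
      (2 + (n * (2 + (T + 1) + 8) + 6)) (Answers G X x (∃ y, φ y) s) := by
  let I (i : ℕ) : State → Prop := Answers G X x (∃ y : Fin n, (y : ℕ) < i ∧ φ y) s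
  have hsucc (i : Fin n) :
      (∃ y : Fin n, (y : ℕ) < i + 1 ∧ φ y) ↔ (∃ y : Fin n, (y : ℕ) < i ∧ φ y) ∨ φ i := by
    simp only [Nat.lt_succ_iff_lt_or_eq, Fin.val_inj, or_and_right, exists_or, exists_eq_left]
  have hinit : HaltsWithin (.assign 2 (.const 0)) s 2 (I 0) :=
    Answers.haltsWithin_assign hs rfl rfl _ (by simp [Expr.eval])
  have hbody (y : Fin n) (s' : State) (hs' : Stores G X (Fin.snoc x y : Fin (k + 1) → Fin n) s')
      (hI : I y s') : HaltsWithin (.cond (.var 2) .skip c) s' (2 + (T + 1)) fun s'' =>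
        Stores G X (Fin.snoc x y : Fin (k + 1) → Fin n) s'' ∧ I (y + 1) s'' := by
    refine haltsWithin_cond (fun h => ?_) fun h => ?_
    · exact ⟨1, s', .skip s', Nat.le_add_left _ _, hs',
        hI.congr (iff_of_true (hI.answer_iff.mp h) ((hsucc y).mpr (.inl (hI.answer_iff.mp h))))⟩
    · refine (hc y s' hs').mono (Nat.le_add_right _ _) fun s'' h'' => ⟨h''.stores, ?_⟩
      have hφ : φ y ↔ ∃ z : Fin n, (z : ℕ) < y + 1 ∧ φ z := by
        rw [hsucc, or_iff_right fun hlt => hI.answer_iff.mpr hlt h]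
      exact hI.trans ⟨(stores_snoc.mp h''.stores).1, h''.outputLength_eq, h''.arrs_eq,
        h''.answer_iff.trans hφ⟩
  refine hinit.seq fun s' hI => (hI.stores.haltsWithin_forEach
    (fun i a s' h => h.setVar_of_le le_rfl a) hbody hI).mono le_rfl fun s'' h => h.2.congr ?_
  simp only [Fin.is_lt, true_and]

section IsPolyDecidable

variable {k : ℕ} {P Q : Query k}

theorem IsPolyDecidable.congr (hP : IsPolyDecidable P) (h : ∀ n G X x, P n G X x ↔ Q n G X x) :
    IsPolyDecidable Q := by
  obtain rfl : P = Q := by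
    funext n G X x
    exact propext (h n G X x)
  exact hP

theorem isPolyDecidable_of_eval (e : Expr)
    (he : ∀ n G X (x : Fin k → Fin n) s, Stores G X x s → (e.eval s ≠ 0 ↔ P n G X x)) :
    IsPolyDecidable P :=
  ⟨.assign 2 e, .C (e.cost + 1), fun n G X x s hs => by
    simpa only [Polynomial.eval_C] using Answers.haltsWithin_assign hs rfl rfl e (he n G X x s hs)⟩

theorem isPolyDecidable_eq (i j : Fin k) : IsPolyDecidable fun _ _ _ x => x i = x j := by
  let d (i j : Fin k) : Expr := .sub (.var (3 + i)) (.var (3 + j))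
  refine isPolyDecidable_of_eval (.sub (.const 1) (.add (d i j) (d j i))) fun n G X x s hs => ?_
  simp only [d, Expr.eval, hs.tuple, Fin.ext_iff]
  omega

theorem isPolyDecidable_adj (i j : Fin k) : IsPolyDecidable fun _ G _ x => G.Adj (x i) (x j) :=
  isPolyDecidable_of_eval (.get 0 (.var (3 + i)) (.var (3 + j))) fun _ _ _ _ _ hs => hs.adj_iff i j

theorem isPolyDecidable_mem (i : Fin k) : IsPolyDecidable fun _ _ X x => x i ∈ X :=
  isPolyDecidable_of_eval (.get 1 (.const 0) (.var (3 + i))) fun _ _ _ _ _ hs => hs.mem_iff i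

namespace IsPolyDecidable

theorem not (hP : IsPolyDecidable P) : IsPolyDecidable fun n G X x => ¬ P n G X x := by
  obtain ⟨c, p, hc⟩ := hP
  refine ⟨.seq c (.assign 2 (.sub (.const 1) (.var 2))), p + .C 4, fun n G X x s hs => ?_⟩
  rw [Polynomial.eval_add, Polynomial.eval_C]
  refine (hc n G X x s hs).seq fun s' h =>
    Answers.haltsWithin_assign h.stores h.outputLength_eq h.arrs_eq _ ?_
  refine Iff.trans ?_ (not_congr h.answer_iff)
  simp only [Expr.eval]
  omega

theorem and (hP : IsPolyDecidable P) (hQ : IsPolyDecidable Q) :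
    IsPolyDecidable fun n G X x => P n G X x ∧ Q n G X x := by
  obtain ⟨c, p, hc⟩ := hP
  obtain ⟨c', p', hc'⟩ := hQ
  refine ⟨.seq c (.cond (.var 2) c' .skip), p + (.C 2 + (p' + .C 1)), fun n G X x s hs => ?_⟩
  simp only [Polynomial.eval_add, Polynomial.eval_C]
  refine (hc n G X x s hs).seq fun s' h => haltsWithin_cond (fun h2 => ?_) fun h2 => ?_
  · refine (hc' n G X x s' h.stores).mono (Nat.le_add_right _ _) fun s'' h' => ?_
    exact (h.trans h').congr (and_iff_right (h.answer_iff.mp h2)).symm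
  · have hP : ¬ P n G X x := fun hP => h.answer_iff.mpr hP h2
    exact ⟨1, s', .skip s', Nat.le_add_left _ _, h.congr (iff_of_false hP fun h => hP h.1)⟩

theorem or (hP : IsPolyDecidable P) (hQ : IsPolyDecidable Q) :
    IsPolyDecidable fun n G X x => P n G X x ∨ Q n G X x :=
  (hP.not.and hQ.not).not.congr fun _ _ _ _ => or_iff_not_and_not.symm

theorem exists_snoc {P : Query (k + 1)} (hP : IsPolyDecidable P) :
    IsPolyDecidable fun n G X x => ∃ y : Fin n, P n G X (Fin.snoc x y : Fin (k + 1) → Fin n) := by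
  obtain ⟨c, p, hc⟩ := hP
  refine ⟨.seq (.assign 2 (.const 0)) (forEach k (.cond (.var 2) .skip c)),
    .C 2 + (.X * (.C 2 + (p + .C 1) + .C 8) + .C 6), fun n G X x s hs => ?_⟩
  simp only [Polynomial.eval_add, Polynomial.eval_mul, Polynomial.eval_C, Polynomial.eval_X]
  exact hs.haltsWithin_exists fun y s hs => hc n G X _ s hs

end IsPolyDecidable

end IsPolyDecidable

theorem isPolyDecidable_withinDist {k : ℕ} (r : ℕ) (i j : Fin k) :
    IsPolyDecidable fun _ G X x => WithinDist G Xᶜ r (x i) (x j) := by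
  induction r generalizing k with
  | zero => exact (isPolyDecidable_mem i).not.and (isPolyDecidable_eq i j)
  | succ r ih =>
    have hnext := ((isPolyDecidable_eq i.castSucc (.last k)).or
      (isPolyDecidable_adj i.castSucc (.last k))).and (ih (.last k) j.castSucc)
    exact ((isPolyDecidable_mem i).not.and hnext.exists_snoc).congr fun n G X x => by
      simp only [Fin.snoc_castSucc, Fin.snoc_last, WithinDist, Set.mem_compl_iff]

theorem isPolyDecidable_mem_candidate : IsPolyDecidable (k := 8) fun _ G X x =>
    x 7 ∈ candidate G X (x 0) (x 1) (x 2) (x 3) (x 4)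
      (reach G X (x 0) (x 5) ∪ reach G X (x 0) (x 6)) := by
  have hadj (i j : Fin 8) : IsPolyDecidable fun _ G _ x => x j ∈ G.neighborSet (x i) :=
    isPolyDecidable_adj i j
  have hreach (i : Fin 8) : IsPolyDecidable fun _ G X x => x 7 ∈ reach G X (x 0) (x i) :=
    (isPolyDecidable_eq i 0).not.and (isPolyDecidable_withinDist 4 i 7)
  exact ((isPolyDecidable_mem 7).or
    (((hadj 0 7).or (hadj 1 7)).and ((hadj 2 7).or (hadj 4 7)))).or
    (((hreach 5).or (hreach 6)).and (((hadj 0 7).or (hadj 2 7)).or (hadj 3 7)))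

/-- Some program appends the members of the family `𝓠`, which may depend on `k` vertices, to the
output in polynomial time. -/
def IsPolyListable {k : ℕ}
    (𝓠 : ∀ n, SimpleGraph (Fin n) → Set (Fin n) → (Fin k → Fin n) → Set (Set (Fin n))) : Prop :=
  ∃ (c : Prog) (p : Polynomial ℕ), ∀ n G X (x : Fin k → Fin n) s, Stores G X x s →
    HaltsWithin c s (p.eval n) fun s' => Stores G X x s' ∧
      outputLength s' ≤ outputLength s + p.eval n ∧
      outputFamily n s' = outputFamily n s ∪ 𝓠 n G X x

section IsPolyListable

variable {n k : ℕ} {s s' : State}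

theorem outputFamily_eq_insert {Y : Set (Fin n)} (hlen : outputLength s' = outputLength s + 1)
    (hold : ∀ i ≠ outputLength s, s'.arrs 2 i = s.arrs 2 i)
    (hnew : ∀ v : Fin n, s'.arrs 2 (outputLength s) v ≠ 0 ↔ v ∈ Y) :
    outputFamily n s' = insert Y (outputFamily n s) := by
  have hY : {v : Fin n | s'.arrs 2 (outputLength s) v ≠ 0} = Y := Set.ext hnew
  have hrow (i : ℕ) (hi : i < outputLength s) :
      {v : Fin n | s'.arrs 2 i v ≠ 0} = {v : Fin n | s.arrs 2 i v ≠ 0} := by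
    rw [hold i hi.ne]
  ext Z
  simp only [outputFamily, hlen, Set.mem_ofPred_eq, Set.mem_insert_iff, Nat.lt_succ_iff_lt_or_eq,
    or_and_right, exists_or, exists_eq_left, hY]
  rw [or_comm]
  exact or_congr_right (exists_congr fun i => and_congr_right fun hi => by rw [hrow i hi])

theorem outputFamily_congr (hvars : s'.vars 1 = s.vars 1) (harr : s'.arrs = s.arrs) :
    outputFamily n s' = outputFamily n s := by
  simp only [outputFamily, outputLength, hvars, harr]

/-- The memory `s'` results from `s` by writing the indicator vector of `Y`, up to entry `i`, into
the first row behind the output. -/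
structure HasWritten (i : ℕ) (Y : Set (Fin n)) (s s' : State) : Prop where
  outputLength_eq : outputLength s' = outputLength s
  row_eq : ∀ j ≠ outputLength s, s'.arrs 2 j = s.arrs 2 j
  entry_iff : ∀ v : Fin n, (v : ℕ) < i → (s'.arrs 2 (outputLength s) v ≠ 0 ↔ v ∈ Y)

theorem HasWritten.put {v : Fin n} {Y : Set (Fin n)} (h : HasWritten v Y s s') {a : ℕ}
    (ha : a ≠ 0 ↔ v ∈ Y) : HasWritten (v + 1) Y s (s'.setArr 2 (outputLength s) v a) where
  outputLength_eq := h.outputLength_eq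
  row_eq j hj := by
    funext u
    simp [State.setArr, hj, h.row_eq j hj]
  entry_iff u hu := by
    obtain hu | hu := Nat.lt_succ_iff_lt_or_eq.mp hu
    · simpa [State.setArr, hu.ne] using h.entry_iff u hu
    · obtain rfl := Fin.ext hu
      simpa [State.setArr] using ha

/-- Append a set to the output, where `c` decides whether the vertex in variable `3 + k` belongs to
it. -/
def appendSet (k : ℕ) (c : Prog) : Prog :=
  .seq (forEach k (.seq c (.put 2 (.var 1) (.var (3 + k)) (.var 2))))
    (.assign 1 (.add (.var 1) (.const 1)))

theorem Stores.haltsWithin_appendSet {T : ℕ} {G : SimpleGraph (Fin n)} {X Y : Set (Fin n)}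
    {x : Fin k → Fin n} {c : Prog} (hs : Stores G X x s)
    (hc : ∀ y s, Stores G X (Fin.snoc x y : Fin (k + 1) → Fin n) s →
      HaltsWithin c s T (Answers G X (Fin.snoc x y : Fin (k + 1) → Fin n) (y ∈ Y) s)) :
    HaltsWithin (appendSet k c) s (n * (T + 4 + 8) + 6 + 4) fun s' => Stores G X x s' ∧
      outputLength s' = outputLength s + 1 ∧
      outputFamily n s' = insert Y (outputFamily n s) := by
  have hbody (y : Fin n) (s' : State) (hs' : Stores G X (Fin.snoc x y : Fin (k + 1) → Fin n) s')
      (hI : HasWritten y Y s s') :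
      HaltsWithin (.seq c (.put 2 (.var 1) (.var (3 + k)) (.var 2))) s' (T + 4) fun s'' =>
        Stores G X (Fin.snoc x y : Fin (k + 1) → Fin n) s'' ∧ HasWritten (y + 1) Y s s'' := by
    refine (hc y s' hs').seq fun s'' h => haltsWithin_put ⟨h.stores.setArr_two _ _ _, ?_⟩
    have hlen : s''.vars 1 = outputLength s := h.outputLength_eq.trans hI.outputLength_eq
    have hy : s''.vars (3 + k) = y := (stores_snoc.mp h.stores).2
    have hI'' : HasWritten y Y s s'' :=
      ⟨hlen, h.arrs_eq ▸ hI.row_eq, h.arrs_eq ▸ hI.entry_iff⟩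
    simpa only [Expr.eval, hlen, hy] using hI''.put h.answer_iff
  have hinit : HasWritten 0 Y s s := ⟨rfl, fun _ _ => rfl, by simp⟩
  refine (hs.haltsWithin_forEach (P := (HasWritten · Y s)) (fun i a s' h => ?_) hbody hinit).seq
    fun s' ⟨hs', h⟩ => haltsWithin_assign ⟨hs'.setVar (.inl rfl) _, ?_, ?_⟩
  · exact ⟨(if_neg (by omega)).trans h.outputLength_eq, h.row_eq, h.entry_iff⟩
  · exact congrArg (· + 1) h.outputLength_eq
  · exact outputFamily_eq_insert (congrArg (· + 1) h.outputLength_eq) h.row_eq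
      fun v => h.entry_iff v v.is_lt

theorem IsPolyDecidable.isPolyListable_singleton {P : Query (k + 1)} (hP : IsPolyDecidable P) :
    IsPolyListable fun n G X x => {{y : Fin n | P n G X (Fin.snoc x y : Fin (k + 1) → Fin n)}} := by
  obtain ⟨c, p, hc⟩ := hP
  refine ⟨appendSet k c, .X * (p + .C 4 + .C 8) + .C 6 + .C 4, fun n G X x s hs => ?_⟩
  simp only [Polynomial.eval_add, Polynomial.eval_mul, Polynomial.eval_C, Polynomial.eval_X]
  let Y : Set (Fin n) := {y | P n G X (Fin.snoc x y : Fin (k + 1) → Fin n)}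
  refine (hs.haltsWithin_appendSet (Y := Y) fun y s hs => hc n G X _ s hs).mono le_rfl
    fun s' ⟨hs', hlen, hfam⟩ => ⟨hs', hlen.trans_le (by omega), ?_⟩
  rw [hfam, Set.union_singleton]

theorem IsPolyListable.iUnion_snoc
    {𝓠 : ∀ n, SimpleGraph (Fin n) → Set (Fin n) → (Fin (k + 1) → Fin n) → Set (Set (Fin n))}
    (h : IsPolyListable 𝓠) :
    IsPolyListable fun n G X x => ⋃ y : Fin n, 𝓠 n G X (Fin.snoc x y : Fin (k + 1) → Fin n) := by
  obtain ⟨c, p, hc⟩ := h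
  refine ⟨forEach k c, .X * (p + .C 8) + .C 6, fun n G X x s hs => ?_⟩
  simp only [Polynomial.eval_add, Polynomial.eval_mul, Polynomial.eval_C, Polynomial.eval_X]
  let I (i : ℕ) (s' : State) : Prop := outputLength s' ≤ outputLength s + i * p.eval n ∧
    outputFamily n s' = outputFamily n s ∪
      ⋃ (y : Fin n) (_ : (y : ℕ) < i), 𝓠 n G X (Fin.snoc x y : Fin (k + 1) → Fin n)
  have hI (i a : ℕ) (s' : State) (h : I i s') : I i (s'.setVar (3 + k) a) := by
    have hvars : (s'.setVar (3 + k) a).vars 1 = s'.vars 1 := if_neg (by omega)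
    exact ⟨hvars.trans_le h.1, (outputFamily_congr hvars rfl).trans h.2⟩
  have hbody (y : Fin n) (s' : State) (hs' : Stores G X (Fin.snoc x y : Fin (k + 1) → Fin n) s')
      (h : I y s') : HaltsWithin c s' (p.eval n) fun s'' =>
        Stores G X (Fin.snoc x y : Fin (k + 1) → Fin n) s'' ∧ I (y + 1) s'' := by
    refine (hc n G X _ s' hs').mono le_rfl fun s'' ⟨hs'', hlen, hfam⟩ => ⟨hs'', hlen.trans ?_, ?_⟩
    · linarith [h.1]
    · rw [hfam, h.2, Set.union_assoc]
      congr 1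
      simp only [Nat.lt_succ_iff_lt_or_eq, Fin.val_inj, Set.iUnion_or, Set.iUnion_union_distrib,
        Set.iUnion_iUnion_eq_left]
  refine (hs.haltsWithin_forEach hI hbody ⟨by simp, by simp⟩).mono le_rfl
    fun s' ⟨hs', hlen, hfam⟩ => ⟨hs', hlen.trans (by linarith), ?_⟩
  simpa only [Fin.is_lt, Set.iUnion_true] using hfam

end IsPolyListable

theorem isPolyListable_candidates : IsPolyListable (k := 0) fun _ G X _ =>
    {Y | ∃ a a' p q b e₁ e₂, Y = candidate G X a a' p q b (reach G X a e₁ ∪ reach G X a e₂)} := by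
  have h := isPolyDecidable_mem_candidate.isPolyListable_singleton.iUnion_snoc.iUnion_snoc
    |>.iUnion_snoc.iUnion_snoc.iUnion_snoc.iUnion_snoc.iUnion_snoc
  convert h using 1
  funext n G X x
  ext Y
  simp only [Set.mem_iUnion, Set.mem_singleton_iff]
  rfl

end Carving

open Carving in
theorem mainTheorem7_general :
    ∃ (prog : Prog) (p : Polynomial ℕ), ∀ (n : ℕ) (G : SimpleGraph (Fin n)), IsP6Free G →
      ∀ X : Set (Fin n), ∃ (t : ℕ) (s : State),
        Exec prog (inputState G X) t s ∧ t ≤ p.eval n ∧ outputLength s ≤ p.eval n ∧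
        ∀ S A B : Set (Fin n), IsFullComponent G S A → IsFullComponent G S B → A ≠ B →
          ¬ IsMesh G B → ∃ S' ∈ outputFamily n s, X ⊆ S' ∧ S' ⊆ S ∪ X ∧
            ∀ D, IsClear G X (A ∪ B) D → Carves G S D S' := by
  obtain ⟨prog, p, hprog⟩ := isPolyListable_candidates
  refine ⟨prog, p, fun n G hG X => ?_⟩
  obtain ⟨t, s, hexec, ht, -, hlen, hfam⟩ :=
    hprog n G X Fin.elim0 (inputState G X) (stores_inputState _)
  have hlen0 : outputLength (inputState G X) = 0 := rfl
  refine ⟨t, s, hexec, ht, by simpa only [hlen0, zero_add] using hlen, ?_⟩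
  intro S A B hA hB hAB hmesh
  obtain ⟨a, a', p, q, b, e₁, e₂, hsub, hcarves⟩ :=
    hG.exists_candidate X A.toFinite B.toFinite hA hB hAB hmesh
  refine ⟨_, hfam ▸ .inr ⟨a, a', p, q, b, e₁, e₂, rfl⟩, fun v hv => .inl (.inl hv), hsub, hcarves⟩

theorem mainTheorem7 (d : ℕ) (hd : 0 < d) :
    ∃ (prog : Carving.Prog) (p : Polynomial ℕ),
      ∀ (n : ℕ) (G : SimpleGraph (Fin n)), Carving.IsP6Free G →
      ∀ Stilde : Set (Fin n),
        ∃ (t : ℕ) (s : Carving.State),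
          Carving.Exec prog (Carving.inputState G Stilde) t s ∧
          t ≤ p.eval n ∧ Carving.outputLength s ≤ p.eval n ∧
          ∀ T : Carving.RootedForest (Fin n), T.IsMaximalTreedepthStructure G d →
          ∀ S : Set (Fin n), Carving.IsMixed G S → Carving.IsAvoiding T d S →
            ∃ S' ∈ Carving.outputFamily n s,
              Stilde ⊆ S' ∧
              S' ∩ T.verts ⊆ S ∪ Stilde ∧
              ∀ Dtilde : Set (Fin n), Carving.IsClarified G S Stilde Dtilde →
              ∀ C : Set (Fin n), Carving.IsComponentIn G (Dtilde \ S') C →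
              ∀ D₁ D₂ : Set (Fin n),
                Carving.IsComponentIn G Sᶜ D₁ → Carving.IsComponentIn G Sᶜ D₂ →
                (C ∩ D₁).Nonempty → (C ∩ D₂).Nonempty → D₁ = D₂ := by
  obtain ⟨prog, p, hprog⟩ := mainTheorem7_general
  refine ⟨prog, p, fun n G hG X => ?_⟩
  obtain ⟨t, s, hexec, ht, hlen, hout⟩ := hprog n G hG X
  refine ⟨t, s, hexec, ht, hlen, fun T _ S hS _ => ?_⟩
  obtain ⟨A, B, hA, hB, hAB, hmesh, hclear⟩ := hS.exists_sides
  obtain ⟨S', hS', hXS', hS'X, hcarves⟩ := hout S A B hA hB hAB hmesh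
  exact ⟨S', hS', hXS', Set.inter_subset_left.trans hS'X,
    fun D hD => hcarves D (hclear X D hD)⟩
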